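/- **Tracts and matroids over tracts.** A *tract* is a commutative monoid $F$ with absorbing element $0$ such that $F^\times=F\setminus\{0\}$ is a group, together with a subset $N_F\subseteq\mathbb N[F^\times]$ (the null set) that contains $0$, is stable under multiplication by $F^\times$, and is such that there is a unique $\varepsilon\in F^\times$ with $1+\varepsilon\in N_F$. A homomorphism of tracts $\varphi:F'\to F$ is a map with $\varphi(0)=0$ that restricts to a group homomorphism $(F')^\times\to F^\times$ and satisfies $\varphi(N_{F'})\subseteq N_F$. A field is a tract, with null set the formal sums whose value in the field is $0$. For $X,Y\in F^n$ write $X\perp Y$ if $\sum_i X_iY_i\in N_F$ (zero terms being omitted). An *$F$-matroid* $M$ on $[n]=\{1,\dots,n\}$ is a matroid $\underline M$ on $[n]$ with sets $\mathcal C(M),\mathcal C^*(M)\subseteq F^n$ of $F$-circuits and $F$-cocircuits, both closed under multiplication by $F^\times$, such that the supports of the $F$-circuits (resp. $F$-cocircuits) are exactly the circuits (resp. cocircuits) of $\underline M$, two $F$-circuits (resp. $F$-cocircuits) with the same support differ by a factor in $F^\times$, and $C\perp C^*$ for all $C\in\mathcal C(M)$, $C^*\in\mathcal C^*(M)$. Its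 *vectors* are the $X\in F^n$ with $X\perp C^*$ for all $C^*\in\mathcal C^*(M)$; its *covectors* are the $X\in F^n$ with $X\perp C$ for all $C\in\mathcal C(M)$. For a homomorphism $\varphi:F'\to F$ and an $F'$-matroid $M$, the push-forward $\varphi_*(M)$ has underlying matroid $\underline M$, and its $F$-circuits (resp. $F$-cocircuits) are all $c\,\varphi(X)$ with $c\in F^\times$ and $X$ an $F'$-circuit (resp. $F'$-cocircuit) of $M$. The map $\varphi$ is *epic* if for all $n$ and all $F'$-matroids $M$ on $[n]$ the map $X\mapsto\varphi(X)$ from the vectors of $M$ to the vectors of $\varphi_*(M)$ is surjective. **Tropical hyperfield.** For an ordered abelian group $\Gamma$ let $\mathbb T_\Gamma=\Gamma\cup\{-\infty\}$, with multiplication given by addition in $\Gamma$ and with $-\infty$ as zero element; a formal sum is null iff it is empty or its maximum is attained at least twice. The tropical hyperfield is $\mathbb T=\mathbb T_{\mathbb R}$, and a $\mathbb T$-matroid is a valuated matroid. **Proposition.** Let $K$ be an infinite field. 1. Let $K\{\!\{T\}\!\}$ be the field of (generalized) Puiseux series with real exponents, i.e. of formal series $c_1T^{a_1}+c_2T^{a_2}+\cdots$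 with $c_i\in K$ and real $a_1<a_2<\cdots$ forming a finite sequence or tending to $+\infty$. Let $v:K\{\!\{T\}\!\}\to\mathbb T$ be the valuation map, which sends a nonzero series to minus its smallest exponent and $0$ to $-\infty$. Then $v$ is epic. Moreover, for every $n$ and every $K\{\!\{T\}\!\}$-matroid $M$ on $[n]$, every covector of the valuated matroid $v_*(M)$ is the image under $v$ of a covector of $M$. 2. The same holds for the field $\bigcup_{m\ge1}K((T^{1/m}))$ of Puiseux series with rational exponents, and its valuation map to the tropical hyperfield $\mathbb T_{\mathbb Q}$ with value group $\mathbb Q$. -/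

import Mathlib

/-! ## Tracts -/

/-- The formal sum in `ℕ[F^×]` given by an element `x` of `F = F^× ∪ {0}`: the generator `x` if
`x ≠ 0`, and the empty sum if `x = 0`. -/
noncomputable def formalTerm {F : Type*} [CommGroupWithZero F] (x : F) : MonoidAlgebra ℕ Fˣ :=
  open Classical in
  if h : x = 0 then 0 else MonoidAlgebra.single (Units.mk0 x h) 1

/-- A tract structure on a commutative monoid `F` with absorbing element `0` such that
`F^× = F ∖ {0}` is a group: a null set `N_F ⊆ ℕ[F^×]` satisfying (T1)-(T3). -/
structure Tract (F : Type*) [CommGroupWithZero F] where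
  nullSet : Set (MonoidAlgebra ℕ Fˣ)
  zero_mem : 0 ∈ nullSet
  existsUnique_neg_one :
    ∃! ε : Fˣ, MonoidAlgebra.single (1 : Fˣ) 1 + MonoidAlgebra.single ε 1 ∈ nullSet
  single_mul_mem : ∀ (g : Fˣ), ∀ s ∈ nullSet, MonoidAlgebra.single g 1 * s ∈ nullSet

/-- A homomorphism of tracts: it preserves `0`, restricts to a group homomorphism on units, and
maps the null set into the null set. -/
structure TractHom {F' F : Type*} [CommGroupWithZero F'] [CommGroupWithZero F]
    (T' : Tract F') (T : Tract F) extends F' →*₀ F where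
  map_nullSet : ∀ s ∈ T'.nullSet,
    MonoidAlgebra.mapDomain (Units.map (toMonoidWithZeroHom : F' →* F)) s ∈ T.nullSet

/-- Orthogonality `X ⊥ Y`: the formal sum `∑ Xᵢ Yᵢ` is null. -/
def Tract.Orthogonal {F : Type*} [CommGroupWithZero F] (T : Tract F) {E : Type*} [Fintype E]
    (X Y : E → F) : Prop :=
  ∑ i, formalTerm (X i * Y i) ∈ T.nullSet

/-! ## Matroids over tracts -/

/-- A (strong) matroid over the tract `T` with ground set `E`. -/
structure TractMatroid {F : Type*} [CommGroupWithZero F] (T : Tract F)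
    (E : Type*) [Fintype E] where
  /-- the underlying matroid -/
  toMatroid : Matroid E
  ground_eq : toMatroid.E = Set.univ
  /-- the `F`-circuits -/
  circuits : Set (E → F)
  /-- the `F`-cocircuits -/
  cocircuits : Set (E → F)
  unit_mul_circuit : ∀ (a : Fˣ), ∀ C ∈ circuits, (fun i => (a : F) * C i) ∈ circuits
  unit_mul_cocircuit : ∀ (a : Fˣ), ∀ C ∈ cocircuits, (fun i => (a : F) * C i) ∈ cocircuits
  isCircuit_support : ∀ C ∈ circuits, toMatroid.IsCircuit (Function.support C)
  isCocircuit_support : ∀ C ∈ cocircuits, toMatroid.IsCocircuit (Function.support C)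
  exists_circuit : ∀ S, toMatroid.IsCircuit S → ∃ C ∈ circuits, Function.support C = S
  exists_cocircuit : ∀ S, toMatroid.IsCocircuit S → ∃ C ∈ cocircuits, Function.support C = S
  circuit_unique : ∀ C ∈ circuits, ∀ D ∈ circuits, Function.support C = Function.support D →
    ∃ a : Fˣ, D = fun i => (a : F) * C i
  cocircuit_unique : ∀ C ∈ cocircuits, ∀ D ∈ cocircuits,
    Function.support C = Function.support D → ∃ a : Fˣ, D = fun i => (a : F) * C i
  orthogonal : ∀ C ∈ circuits, ∀ D ∈ cocircuits, T.Orthogonal C D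

namespace TractMatroid

variable {F : Type*} [CommGroupWithZero F] {T : Tract F} {E : Type*} [Fintype E]

/-- The `F`-vectors: everything orthogonal to all `F`-cocircuits. -/
def vectors (M : TractMatroid T E) : Set (E → F) :=
  {X | ∀ D ∈ M.cocircuits, T.Orthogonal X D}

/-- The `F`-covectors: everything orthogonal to all `F`-circuits. -/
def covectors (M : TractMatroid T E) : Set (E → F) :=
  {X | ∀ C ∈ M.circuits, T.Orthogonal X C}

end TractMatroid

/-! ## Push-forward -/

section PushForward

variable {F' F : Type*} [CommGroupWithZero F'] [CommGroupWithZero F]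
  {T' : Tract F'} {T : Tract F} {E : Type*} [Fintype E]

theorem mapDomain_formalTerm (φ : F' →*₀ F) (x : F') :
    MonoidAlgebra.mapDomain (Units.map (φ : F' →* F)) (formalTerm x) = formalTerm (φ x) := by
  classical
  unfold formalTerm
  by_cases h : x = 0
  · simp [h]
  · have h2 : φ x ≠ 0 := (map_ne_zero φ).2 h
    rw [dif_neg h, dif_neg h2, MonoidAlgebra.mapDomain_single]
    congr 1
    ext
    simp

theorem single_mul_formalTerm (g : Fˣ) (x : F) :
    MonoidAlgebra.single g 1 * formalTerm x = formalTerm ((g : F) * x) := by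
  classical
  unfold formalTerm
  by_cases h : x = 0
  · simp [h]
  · have h2 : (g : F) * x ≠ 0 := mul_ne_zero g.ne_zero h
    rw [dif_neg h, dif_neg h2, MonoidAlgebra.single_mul_single]
    congr 1
    ext
    simp

theorem TractHom.orthogonal_map (φ : TractHom T' T) {X Y : E → F'} (h : T'.Orthogonal X Y)
    (a b : Fˣ) :
    T.Orthogonal (fun i => (a : F) * φ.toMonoidWithZeroHom (X i))
      (fun i => (b : F) * φ.toMonoidWithZeroHom (Y i)) := by
  have h1 := T.single_mul_mem (a * b) _ (φ.map_nullSet _ h)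
  unfold Tract.Orthogonal
  convert h1 using 1
  have h2 : ∀ s : Finset E,
      MonoidAlgebra.mapDomain (Units.map (φ.toMonoidWithZeroHom : F' →* F))
        (∑ i ∈ s, formalTerm (X i * Y i))
      = ∑ i ∈ s, formalTerm (φ.toMonoidWithZeroHom (X i * Y i)) := by
    classical
    intro s
    induction s using Finset.induction_on with
    | empty => simp
    | insert i s hi ih =>
      rw [Finset.sum_insert hi, Finset.sum_insert hi, MonoidAlgebra.mapDomain_add, ih,
        mapDomain_formalTerm]
  rw [h2, Finset.mul_sum]
  refine Finset.sum_congr rfl fun i _ => ?_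
  rw [single_mul_formalTerm, map_mul, Units.val_mul, mul_mul_mul_comm]

theorem support_unit_mul_map {E : Type*} (φ : TractHom T' T) (a : Fˣ) (X : E → F') :
    Function.support (fun i => (a : F) * φ.toMonoidWithZeroHom (X i)) = Function.support X := by
  ext i
  simp

/-- All vectors of the form `c φ(X)` with `c ∈ F^×` and `X ∈ S`. -/
def TractHom.scaledImage (φ : TractHom T' T) (S : Set (E → F')) : Set (E → F) :=
  {Y | ∃ c : Fˣ, ∃ X ∈ S, Y = fun i => (c : F) * φ.toMonoidWithZeroHom (X i)}

/-- The push-forward `φ_*(M)`: same underlying matroid; its `F`-circuits (`F`-cocircuits) are the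
`c φ(X)` with `c ∈ F^×` and `X` an `F'`-circuit (`F'`-cocircuit) of `M`. -/
def TractMatroid.pushforward (φ : TractHom T' T) (M : TractMatroid T' E) : TractMatroid T E where
  toMatroid := M.toMatroid
  ground_eq := M.ground_eq
  circuits := φ.scaledImage M.circuits
  cocircuits := φ.scaledImage M.cocircuits
  unit_mul_circuit := by
    rintro a _ ⟨c, X, hX, rfl⟩
    exact ⟨a * c, X, hX, by ext i; simp [mul_assoc]⟩
  unit_mul_cocircuit := by
    rintro a _ ⟨c, X, hX, rfl⟩
    exact ⟨a * c, X, hX, by ext i; simp [mul_assoc]⟩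
  isCircuit_support := by
    rintro _ ⟨c, X, hX, rfl⟩
    rw [support_unit_mul_map]
    exact M.isCircuit_support X hX
  isCocircuit_support := by
    rintro _ ⟨c, X, hX, rfl⟩
    rw [support_unit_mul_map]
    exact M.isCocircuit_support X hX
  exists_circuit := by
    intro S hS
    obtain ⟨C, hC, h⟩ := M.exists_circuit S hS
    exact ⟨_, ⟨1, C, hC, rfl⟩, by rw [support_unit_mul_map, h]⟩
  exists_cocircuit := by
    intro S hS
    obtain ⟨C, hC, h⟩ := M.exists_cocircuit S hS
    exact ⟨_, ⟨1, C, hC, rfl⟩, by rw [support_unit_mul_map, h]⟩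
  circuit_unique := by
    rintro _ ⟨c, X, hX, rfl⟩ _ ⟨d, Y, hY, rfl⟩ h
    rw [support_unit_mul_map, support_unit_mul_map] at h
    obtain ⟨a, rfl⟩ := M.circuit_unique X hX Y hY h
    refine ⟨d * Units.map (φ.toMonoidWithZeroHom : F' →* F) a * c⁻¹, ?_⟩
    ext i
    simp [mul_assoc]
  cocircuit_unique := by
    rintro _ ⟨c, X, hX, rfl⟩ _ ⟨d, Y, hY, rfl⟩ h
    rw [support_unit_mul_map, support_unit_mul_map] at h
    obtain ⟨a, rfl⟩ := M.cocircuit_unique X hX Y hY h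
    refine ⟨d * Units.map (φ.toMonoidWithZeroHom : F' →* F) a * c⁻¹, ?_⟩
    ext i
    simp [mul_assoc]
  orthogonal := by
    rintro _ ⟨c, X, hX, rfl⟩ _ ⟨d, Y, hY, rfl⟩
    exact φ.orthogonal_map (M.orthogonal X hX Y hY) c d

theorem TractHom.map_mem_vectors (φ : TractHom T' T) (M : TractMatroid T' E) {X : E → F'}
    (hX : X ∈ M.vectors) : (fun i => φ.toMonoidWithZeroHom (X i)) ∈ (M.pushforward φ).vectors := by
  rintro _ ⟨c, Y, hY, rfl⟩
  simpa using φ.orthogonal_map (hX Y hY) 1 c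

theorem TractHom.map_mem_covectors (φ : TractHom T' T) (M : TractMatroid T' E) {X : E → F'}
    (hX : X ∈ M.covectors) :
    (fun i => φ.toMonoidWithZeroHom (X i)) ∈ (M.pushforward φ).covectors := by
  rintro _ ⟨c, Y, hY, rfl⟩
  simpa using φ.orthogonal_map (hX Y hY) 1 c

/-- The natural map from the vectors of `M` to the vectors of `φ_*(M)`. -/
def TractHom.vectorMap (φ : TractHom T' T) (M : TractMatroid T' E) :
    M.vectors → (M.pushforward φ).vectors :=
  fun X => ⟨fun i => φ.toMonoidWithZeroHom (X.1 i), φ.map_mem_vectors M X.2⟩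

/-- The natural map from the covectors of `M` to the covectors of `φ_*(M)`. -/
def TractHom.covectorMap (φ : TractHom T' T) (M : TractMatroid T' E) :
    M.covectors → (M.pushforward φ).covectors :=
  fun X => ⟨fun i => φ.toMonoidWithZeroHom (X.1 i), φ.map_mem_covectors M X.2⟩

/-- `φ : F' → F` is epic if the vectors of `M` surject onto the vectors of `φ_*(M)` for every
`F'`-matroid `M`. -/
def TractHom.IsEpic (φ : TractHom T' T) : Prop :=
  ∀ (n : ℕ) (M : TractMatroid T' (Fin n)), Function.Surjective (φ.vectorMap M)

end PushForward

/-! ## Fields and the tropical hyperfield as tracts -/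

/-- The value in `K` of a formal sum of units of `K`. -/
noncomputable def formalSumValue {K : Type*} [Field K] (s : MonoidAlgebra ℕ Kˣ) : K :=
  s.coeff.sum fun x n => n • (x : K)

theorem formalSumValue_add {K : Type*} [Field K] (s t : MonoidAlgebra ℕ Kˣ) :
    formalSumValue (s + t) = formalSumValue s + formalSumValue t := by
  unfold formalSumValue
  rw [MonoidAlgebra.coeff_add]
  exact Finsupp.sum_add_index' (by simp) (by intro a b c; exact add_smul b c (a : K))

theorem formalSumValue_single {K : Type*} [Field K] (x : Kˣ) (n : ℕ) :
    formalSumValue (MonoidAlgebra.single x n) = n • (x : K) := by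
  unfold formalSumValue
  rw [MonoidAlgebra.coeff_single]
  exact Finsupp.sum_single_index (by simp)

theorem formalSumValue_single_mul {K : Type*} [Field K] (g : Kˣ) (s : MonoidAlgebra ℕ Kˣ) :
    formalSumValue (MonoidAlgebra.single g 1 * s) = (g : K) * formalSumValue s := by
  induction s using MonoidAlgebra.induction_linear with
  | zero => simp [formalSumValue]
  | add s t hs ht => rw [mul_add, formalSumValue_add, formalSumValue_add, hs, ht, mul_add]
  | single x n =>
    rw [MonoidAlgebra.single_mul_single, formalSumValue_single, formalSumValue_single]
    simp
    ring

/-- A field `K` as a tract: a formal sum is null iff it sums to `0` in `K`. -/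
noncomputable def fieldTract (K : Type*) [Field K] : Tract K where
  nullSet := {s | formalSumValue s = 0}
  zero_mem := by simp [formalSumValue]
  existsUnique_neg_one := by
    refine ⟨-1, ?_, ?_⟩
    · simp [formalSumValue_add, formalSumValue_single]
    · intro ε h
      simp only [Set.mem_ofPred_eq, formalSumValue_add, formalSumValue_single] at h
      apply Units.ext
      rw [Units.val_neg, Units.val_one]
      rw [one_smul, one_smul, Units.val_one] at h
      exact (neg_eq_of_add_eq_zero_right h).symm
  single_mul_mem := by
    intro g s hs
    simp only [Set.mem_ofPred_eq] at hs ⊢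
    rw [formalSumValue_single_mul, hs, mul_zero]

/-- The maximum of the terms of the formal sum `s` is attained at least twice (counted with
multiplicity). Equal terms of `s` are collected, so this means that the coefficient of the maximal
term is at least `2`. -/
def MaxAttainedTwice {G : Type*} [CommGroup G] [LinearOrder G]
    (s : MonoidAlgebra ℕ (WithZero G)ˣ) : Prop :=
  ∃ m : (WithZero G)ˣ, 2 ≤ s.coeff m ∧
    ∀ x : (WithZero G)ˣ, s.coeff x ≠ 0 → (x : WithZero G) ≤ (m : WithZero G)

/-- The tropical hyperfield with value group `Γ`, in the "max" convention. The carrier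
`WithZero (Multiplicative Γ)` is `Γ ∪ {-∞}` with multiplication given by addition in `Γ` and with
`-∞` as the zero element. A formal sum is null iff it is empty or its maximum is attained at least
twice. The usual tropical hyperfield `𝕋` is the case `Γ = ℝ`. -/
def tropicalTract (Γ : Type*) [AddCommGroup Γ] [LinearOrder Γ] [IsOrderedAddMonoid Γ] :
    Tract (WithZero (Multiplicative Γ)) where
  nullSet := {s | s = 0 ∨ MaxAttainedTwice s}
  zero_mem := Or.inl rfl
  existsUnique_neg_one := by
    classical
    refine ⟨1, Or.inr ⟨1, ?_, ?_⟩, ?_⟩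
    · simp
    · intro x hx
      by_contra h
      have h2 : (1 : (WithZero (Multiplicative Γ))ˣ) ≠ x := by
        rintro rfl
        exact h le_rfl
      simp [h2] at hx
    · rintro ε (h | ⟨m, hm, -⟩)
      · have h2 := congrArg (fun s => s.coeff 1) h
        simp at h2
      · by_contra hne
        simp only [MonoidAlgebra.coeff_add, MonoidAlgebra.coeff_single, Finsupp.add_apply,
          Finsupp.single_apply] at hm
        split_ifs at hm with h1 h2
        · exact hne (h2.trans h1.symm)
        all_goals omega
  single_mul_mem := by
    rintro g s (rfl | ⟨m, hm, hmax⟩)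
    · left
      simp
    · right
      have key : ∀ x, (MonoidAlgebra.single g 1 * s).coeff x = s.coeff (g⁻¹ * x) := by
        intro x
        rw [MonoidAlgebra.coeff_single_mul_eq_mul_coeff (m₂ := g⁻¹ * x)]
        · simp
        · intro y _
          rw [eq_inv_mul_iff_mul_eq]
      refine ⟨g * m, ?_, ?_⟩
      · rw [key]
        simpa using hm
      · intro x hx
        rw [key] at hx
        have h2 := mul_le_mul_right (hmax _ hx) (g : WithZero (Multiplicative Γ))
        rw [← Units.val_mul, ← Units.val_mul, mul_inv_cancel_left] at h2
        exact h2

/-! ## Fields of Puiseux series and their valuations -/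

/-- A series has left-finite support if it has only finitely many exponents below every bound. -/
def HasLeftFiniteSupport {K : Type*} [Field K] (f : HahnSeries ℝ K) : Prop :=
  ∀ B : ℝ, (f.support ∩ Set.Iio B).Finite

theorem HasLeftFiniteSupport.add {K : Type*} [Field K] {f g : HahnSeries ℝ K}
    (hf : HasLeftFiniteSupport f) (hg : HasLeftFiniteSupport g) :
    HasLeftFiniteSupport (f + g) := by
  intro B
  refine ((hf B).union (hg B)).subset ?_
  rintro x ⟨hx, hB⟩
  rcases HahnSeries.support_add_subset _ _ hx with h | h
  · exact Or.inl ⟨h, hB⟩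
  · exact Or.inr ⟨h, hB⟩

theorem HasLeftFiniteSupport.single {K : Type*} [Field K] (a : ℝ) (c : K) :
    HasLeftFiniteSupport (HahnSeries.single a c) := by
  intro B
  refine (Set.finite_singleton a).subset ?_
  rintro x ⟨hx, -⟩
  exact HahnSeries.support_single_subset hx

theorem HasLeftFiniteSupport.neg {K : Type*} [Field K] {f : HahnSeries ℝ K}
    (hf : HasLeftFiniteSupport f) : HasLeftFiniteSupport (-f) := by
  intro B
  rw [HahnSeries.support_neg]
  exact hf B

theorem HasLeftFiniteSupport.mul {K : Type*} [Field K] {f g : HahnSeries ℝ K}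
    (hf : HasLeftFiniteSupport f) (hg : HasLeftFiniteSupport g) :
    HasLeftFiniteSupport (f * g) := by
  intro B
  refine ((hf (B - g.order)).add (hg (B - f.order))).subset ?_
  rintro x ⟨hx, hB⟩
  obtain ⟨a, ha, b, hb, rfl⟩ := HahnSeries.support_mul_subset hx
  have h1 : f.order ≤ a := HahnSeries.order_le_of_coeff_ne_zero ha
  have h2 : g.order ≤ b := HahnSeries.order_le_of_coeff_ne_zero hb
  simp only [Set.mem_Iio] at hB
  exact ⟨a, ⟨ha, by simp only [Set.mem_Iio]; linarith⟩,
    b, ⟨hb, by simp only [Set.mem_Iio]; linarith⟩, rfl⟩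

theorem HasLeftFiniteSupport.sum_pow {K : Type*} [Field K] {g : HahnSeries ℝ K}
    (hg : HasLeftFiniteSupport g) (n : ℕ) :
    HasLeftFiniteSupport (∑ k ∈ Finset.range n, g ^ k) := by
  have hp : ∀ k : ℕ, HasLeftFiniteSupport (g ^ k) := by
    intro k
    induction k with
    | zero => rw [pow_zero]; exact HasLeftFiniteSupport.single 0 1
    | succ k ih => rw [pow_succ]; exact ih.mul hg
  induction n with
  | zero => intro B; simp
  | succ n ih => rw [Finset.sum_range_succ]; exact ih.add (hp n)

theorem HasLeftFiniteSupport.inv {K : Type*} [Field K] {f : HahnSeries ℝ K}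
    (hf : HasLeftFiniteSupport f) : HasLeftFiniteSupport f⁻¹ := by
  by_cases h0 : f = 0
  · subst h0
    rw [inv_zero]
    exact hf
  set u : HahnSeries ℝ K := HahnSeries.single (-f.order) (f.leadingCoeff)⁻¹ with hu
  have hlc : f.leadingCoeff ≠ 0 := HahnSeries.leadingCoeff_ne_zero.2 h0
  have hu0 : u ≠ 0 := by
    rw [hu]
    exact HahnSeries.single_ne_zero (inv_ne_zero hlc)
  set g : HahnSeries ℝ K := 1 - u * f with hg
  have huL : HasLeftFiniteSupport u := HasLeftFiniteSupport.single _ _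
  have hgL : HasLeftFiniteSupport g := by
    rw [hg, sub_eq_add_neg]
    exact HasLeftFiniteSupport.add (HasLeftFiniteSupport.single 0 1) (huL.mul hf).neg
  have hcoeff : ∀ x : ℝ, (u * f).coeff x = (f.leadingCoeff)⁻¹ * f.coeff (x + f.order) := by
    intro x
    have h := HahnSeries.coeff_single_mul_add (r := (f.leadingCoeff)⁻¹) (x := f)
      (a := x + f.order) (b := -f.order)
    rw [← h, hu]
    congr 1
    ring
  have hgpos : ∀ x, g.coeff x ≠ 0 → 0 < x := by
    intro x hx
    by_contra hneg
    apply hx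
    rw [hg, HahnSeries.coeff_sub, hcoeff, HahnSeries.coeff_one]
    rcases (not_lt.1 hneg).lt_or_eq with hlt | rfl
    · rw [if_neg hlt.ne, HahnSeries.coeff_eq_zero_of_lt_order (by linarith)]
      simp
    · rw [if_pos rfl, zero_add, ← HahnSeries.leadingCoeff_eq, inv_mul_cancel₀ hlc, sub_self]
  set h : HahnSeries ℝ K := (u * f)⁻¹ with hh
  have hfinv : f⁻¹ = u * h := by
    rw [hh, mul_inv, ← mul_assoc, mul_inv_cancel₀ hu0, one_mul]
  have hgh : (1 - g) * h = 1 := by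
    rw [hg, sub_sub_cancel, hh]
    exact mul_inv_cancel₀ (mul_ne_zero hu0 h0)
  have hexp : ∀ n : ℕ, h = (∑ k ∈ Finset.range n, g ^ k) + g ^ n * h := by
    intro n
    have e := mul_neg_geom_sum g n
    have e2 : (∑ k ∈ Finset.range n, g ^ k) = (1 - g ^ n) * h := by
      rw [← e, mul_right_comm, hgh, one_mul]
    rw [e2]
    ring
  have hhL : HasLeftFiniteSupport h := by
    by_cases hg0 : g = 0
    · have : h = 1 := by simpa [hg0] using hgh
      rw [this]
      exact HasLeftFiniteSupport.single 0 1
    intro B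
    have hord : 0 < g.order := hgpos _ (HahnSeries.coeff_order_eq_zero.not.2 hg0)
    obtain ⟨n, hn⟩ := exists_nat_gt ((B - h.order) / g.order)
    rw [div_lt_iff₀ hord] at hn
    refine ((hgL.sum_pow n) B).subset ?_
    rintro x ⟨hx, hB⟩
    refine ⟨?_, hB⟩
    simp only [Set.mem_Iio] at hB
    rw [HahnSeries.mem_support] at hx ⊢
    intro hz
    apply hx
    rw [hexp n, HahnSeries.coeff_add, hz, zero_add]
    have hh0 : h ≠ 0 := inv_ne_zero (mul_ne_zero hu0 h0)
    apply HahnSeries.coeff_eq_zero_of_lt_order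
    rw [HahnSeries.order_mul (pow_ne_zero n hg0) hh0, HahnSeries.order_pow, nsmul_eq_mul]
    linarith
  rw [hfinv]
  exact huL.mul hhL

/-- The field of (generalized) Puiseux series over `K` with real exponents: formal series
`c₁ T^{a₁} + c₂ T^{a₂} + ⋯` with `cᵢ ∈ K` whose real exponents `a₁ < a₂ < ⋯` form a finite
sequence or tend to `+∞`. -/
def RealPuiseuxSeries (K : Type*) [Field K] : Subfield (HahnSeries ℝ K) where
  carrier := {f | HasLeftFiniteSupport f}
  mul_mem' hf hg := HasLeftFiniteSupport.mul hf hg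
  one_mem' := HasLeftFiniteSupport.single 0 1
  add_mem' hf hg := HasLeftFiniteSupport.add hf hg
  zero_mem' := by intro B; simp
  neg_mem' hf := HasLeftFiniteSupport.neg hf
  inv_mem' _ hf := HasLeftFiniteSupport.inv hf

/-- The additive map `ℤ → ℚ`, `k ↦ k / n`. -/
def intDivHom (n : ℕ+) : ℤ →+ ℚ where
  toFun k := (k : ℚ) / (n : ℕ)
  map_zero' := by simp
  map_add' a b := by push_cast; ring

theorem intDivHom_le_iff (n : ℕ+) (a b : ℤ) : intDivHom n a ≤ intDivHom n b ↔ a ≤ b := by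
  have hn : (0 : ℚ) < (n : ℕ) := by exact_mod_cast n.pos
  change (a : ℚ) / (n : ℕ) ≤ (b : ℚ) / (n : ℕ) ↔ a ≤ b
  rw [div_le_div_iff_of_pos_right hn]
  exact Int.cast_le

theorem intDivHom_injective (n : ℕ+) : Function.Injective (intDivHom n) := by
  intro a b h
  exact le_antisymm ((intDivHom_le_iff n a b).1 h.le) ((intDivHom_le_iff n b a).1 h.ge)

/-- The embedding `K((T)) → K((T^ℚ))`, `T ↦ T^{1/n}`, whose image is `K((T^{1/n}))`. -/
noncomputable def laurentRootHom (K : Type*) [Field K] (n : ℕ+) :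
    HahnSeries ℤ K →+* HahnSeries ℚ K :=
  HahnSeries.embDomainRingHom (intDivHom n) (intDivHom_injective n) (intDivHom_le_iff n)

/-- The field of Puiseux series `⋃ₙ K((T^{1/n}))` over `K` with rational exponents, as a subfield
of `K((T^ℚ))`. (The supremum is directed, hence a union.) -/
noncomputable def PuiseuxSeries (K : Type*) [Field K] : Subfield (HahnSeries ℚ K) :=
  ⨆ n : ℕ+, (laurentRootHom K n).fieldRange

section Valuation

variable {Γ : Type*} [AddCommGroup Γ] [LinearOrder Γ] [IsOrderedAddMonoid Γ]
  {K : Type*} [Field K]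

/-- The valuation `K((T^Γ)) → Γ ∪ {-∞}` in the "max" convention: a nonzero series goes to minus
its smallest exponent, and `0` goes to `-∞`. -/
noncomputable def hahnValue (x : HahnSeries Γ K) : WithZero (Multiplicative Γ) :=
  open Classical in
  if x = 0 then 0 else WithZero.exp (-x.order)

theorem hahnValue_of_ne_zero {Γ K : Type*} [AddCommGroup Γ] [LinearOrder Γ] [Field K]
    {x : HahnSeries Γ K} (hx : x ≠ 0) : hahnValue x = WithZero.exp (-x.order) := if_neg hx

/-- The valuation on a subfield `L` of `K((T^Γ))` as a multiplicative map. -/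
noncomputable def hahnValueHom (L : Subfield (HahnSeries Γ K)) :
    L →*₀ WithZero (Multiplicative Γ) where
  toFun x := hahnValue (x : HahnSeries Γ K)
  map_zero' := by simp [hahnValue]
  map_one' := by
    rw [hahnValue_of_ne_zero (by simp)]
    simp
  map_mul' x y := by
    by_cases hx : (x : HahnSeries Γ K) = 0
    · simp [hahnValue, hx]
    by_cases hy : (y : HahnSeries Γ K) = 0
    · simp [hahnValue, hy]
    rw [Subfield.coe_mul, hahnValue_of_ne_zero hx, hahnValue_of_ne_zero hy,
      hahnValue_of_ne_zero (mul_ne_zero hx hy), HahnSeries.order_mul hx hy, neg_add,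
      WithZero.exp_add]

/-- The valuation on a subfield `L` of `K((T^Γ))` as a homomorphism of tracts from the field `L`
to the tropical hyperfield with value group `Γ`. -/
noncomputable def tropicalValuation (L : Subfield (HahnSeries Γ K)) :
    TractHom (fieldTract L) (tropicalTract Γ) where
  toMonoidWithZeroHom := hahnValueHom L
  map_nullSet := by
    classical
    intro s hs
    by_cases hs0 : s = 0
    · left
      simp [hs0]
    right
    have hsupp : s.coeff.support.Nonempty := by
      rw [Finsupp.support_nonempty_iff]
      simpa using hs0
    obtain ⟨m, hm, hmin⟩ := s.coeff.support.exists_min_image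
      (fun x : Lˣ => ((x : L) : HahnSeries Γ K).order) hsupp
    have hne : ∀ x : Lˣ, ((x : L) : HahnSeries Γ K) ≠ 0 := by
      intro x h
      exact x.ne_zero (Subtype.ext h)
    set ψ : Lˣ →* (WithZero (Multiplicative Γ))ˣ :=
      Units.map ((hahnValueHom L : L →*₀ _) : L →* WithZero (Multiplicative Γ)) with hψ
    have hval : ∀ x : Lˣ, ((ψ x : (WithZero (Multiplicative Γ))ˣ) : WithZero (Multiplicative Γ)) =
        WithZero.exp (-((x : L) : HahnSeries Γ K).order) :=
      fun x => hahnValue_of_ne_zero (hne x)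
    have hmap : ∀ z, (MonoidAlgebra.mapDomain ψ s).coeff z
        = ∑ x ∈ s.coeff.support, if ψ x = z then s.coeff x else 0 := by
      intro z
      change (Finsupp.mapDomain ψ s.coeff) z = _
      rw [Finsupp.mapDomain, Finsupp.sum, Finsupp.finsetSum_apply]
      exact Finset.sum_congr rfl fun x _ => Finsupp.single_apply
    refine ⟨ψ m, ?_, ?_⟩
    · rw [hmap]
      by_contra hlt
      have hm1 : 1 ≤ s.coeff m := Nat.one_le_iff_ne_zero.2 (Finsupp.mem_support_iff.1 hm)
      rw [← Finset.add_sum_erase _ _ hm, if_pos rfl] at hlt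
      have hm2 : s.coeff m = 1 := by omega
      have hrest : ∑ x ∈ s.coeff.support.erase m, (if ψ x = ψ m then s.coeff x else 0) = 0 := by
        omega
      rw [Finset.sum_eq_zero_iff] at hrest
      have hsum : ∑ x ∈ s.coeff.support, s.coeff x • ((x : L) : HahnSeries Γ K) = 0 := by
        have h := congrArg (L.subtype) hs
        simpa [formalSumValue, Finsupp.sum] using h
      have hc := congrArg
        (fun f : HahnSeries Γ K => f.coeff ((m : L) : HahnSeries Γ K).order) hsum
      simp only [HahnSeries.coeff_sum, HahnSeries.coeff_zero] at hc
      rw [← Finset.add_sum_erase _ _ hm, hm2, one_smul, Finset.sum_eq_zero, add_zero] at hc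
      · exact HahnSeries.coeff_order_eq_zero.not.2 (hne m) hc
      · intro x hx
        have hxs := Finset.mem_of_mem_erase hx
        have hx1 : ψ x ≠ ψ m := by
          intro he
          have h := hrest x hx
          rw [if_pos he] at h
          exact Finsupp.mem_support_iff.1 hxs h
        have hlt2 : ((m : L) : HahnSeries Γ K).order < ((x : L) : HahnSeries Γ K).order := by
          refine lt_of_le_of_ne (hmin x hxs) ?_
          intro he
          apply hx1
          apply Units.ext
          rw [hval, hval, he]
        rw [HahnSeries.coeff_smul, HahnSeries.coeff_eq_zero_of_lt_order hlt2, smul_zero]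
    · intro z hz
      rw [hmap] at hz
      obtain ⟨x, hx, hxz⟩ := Finset.exists_ne_zero_of_sum_ne_zero hz
      have hxe : ψ x = z := by
        by_contra h
        exact hxz (if_neg h)
      rw [← hxe, hval, hval, WithZero.exp_le_exp]
      exact neg_le_neg (hmin x hx)

end Valuation

/-! ## Linear algebra over a valued field -/

section ValuedLinearAlgebra

variable {L Γ₀ ι : Type*} [Field L] [LinearOrderedCommGroupWithZero Γ₀] [Fintype ι]

/-! Let `W` be the space orthogonal to the circuits of `M`; it contains the cocircuits. A vector `X`
of the push-forward is lifted to an element of `W^⊥` with coordinatewise value `X`. If `X` is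
tropically orthogonal to the value of `D`, then the maximum of `X k * v (D k)` is not attained
exactly once with a nonzero value; in the terms below, `D` is dominated at no coordinate.

This property passes from cocircuits to all of `W` (`not_dominatedAt_of_mem`). Every nonzero `D` in
`W` contains the support of a cocircuit `C`, and subtracting a suitable multiple of `C` from a
dominated `D` gives a dominated vector of smaller support, unless `C` itself is dominated.

Choose `t k` of value `X k` and scale the coordinates of `W` by `t`. It now suffices to find a
vector `y` orthogonal to the scaled space with `v (y k) = 1` wherever `X k ≠ 0`, for then `t * y` is
the lift. For one coordinate, such an integral `y` comes from a reduced echelon basis over the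
valuation ring (`exists_integral_orthogonal`). A linear combination with coefficients in `K` then
serves all coordinates at once: only finitely many nonzero linear forms over the infinite field `K`
must be kept from vanishing (`exists_orthogonal_forall_unit`).

The only property of the series field that matters is that it contains all monomials, so both fields
are treated together. Covectors are the same statement for the dual matroid. -/

/-- The weighted value of `D` is attained, and nonzero, at the coordinate `i` only. -/
def DominatedAt (v : Valuation L Γ₀) (X : ι → Γ₀) (D : ι → L) (i : ι) : Prop :=
  X i * v (D i) ≠ 0 ∧ ∀ k, k ≠ i → X k * v (D k) < X i * v (D i)

/-- A finite-dimensional space of functions over a valued field has a basis in reduced echelon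
form with entries in the valuation ring. -/
theorem exists_integral_echelon_basis [DecidableEq ι] (v : Valuation L Γ₀) (n : ℕ) :
    ∀ W : Submodule L (ι → L), Module.finrank L W = n →
      ∃ (B : Finset ι) (D : ι → ι → L), (∀ b ∈ B, D b ∈ W) ∧
        (∀ b ∈ B, ∀ c ∈ B, D b c = if b = c then 1 else 0) ∧
        (∀ b ∈ B, ∀ k, v (D b k) ≤ 1) ∧
        ∀ w ∈ W, w = ∑ b ∈ B, w b • D b := by
  induction n using Nat.strong_induction_on with
  | _ n ih =>
    intro W hW
    by_cases h0 : W = ⊥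
    · refine ⟨∅, 0, by simp, by simp, by simp, ?_⟩
      intro w hw
      simpa [h0] using hw
    obtain ⟨w₀, hw₀, hne⟩ := Submodule.exists_mem_ne_zero_of_ne_bot h0
    obtain ⟨j, hj⟩ := Function.ne_iff.1 hne
    -- The pivot is a coordinate of maximal value, so that dividing by it leaves all entries
    -- integral. The induction continues in the hyperplane section where this coordinate vanishes.
    obtain ⟨a, -, ha⟩ := Finset.univ.exists_max_image (fun k => v (w₀ k)) ⟨j, Finset.mem_univ j⟩
    have ha0 : w₀ a ≠ 0 := by
      intro h
      have h1 := ha j (Finset.mem_univ j)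
      rw [h, map_zero, le_zero_iff, map_eq_zero] at h1
      exact hj h1
    set w : ι → L := (w₀ a)⁻¹ • w₀ with hw
    have hwW : w ∈ W := W.smul_mem _ hw₀
    have hwa : w a = 1 := by simp [hw, ha0]
    have hwv : ∀ k, v (w k) ≤ 1 := by
      intro k
      have h1 : 0 < v (w₀ a) := by simpa [zero_lt_iff] using ha0
      rw [hw, Pi.smul_apply, smul_eq_mul, map_mul, map_inv₀, inv_mul_le_iff₀ h1, mul_one]
      exact ha k (Finset.mem_univ k)
    set W' : Submodule L (ι → L) := W ⊓ LinearMap.ker (LinearMap.proj (R := L) a) with hW'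
    have hmem : ∀ x, x ∈ W' ↔ x ∈ W ∧ x a = 0 := by
      intro x
      simp [hW']
    have hlt : W' < W := by
      refine lt_of_le_of_ne inf_le_left ?_
      intro h
      have h1 := ((hmem w).1 (h ▸ hwW)).2
      rw [hwa] at h1
      exact one_ne_zero h1
    obtain ⟨B, D, h1, h2, h3, h4⟩ := ih _ (hW ▸ Submodule.finrank_lt_finrank_of_lt hlt) W' rfl
    have hDa : ∀ b ∈ B, D b a = 0 := fun b hb => ((hmem _).1 (h1 b hb)).2
    have haB : a ∉ B := by
      intro h
      have h5 := h2 a h a h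
      rw [hDa a h, if_pos rfl] at h5
      exact zero_ne_one h5
    -- Clearing the old pivots from the new row keeps it integral, because the multipliers `w b` and
    -- the rows `D b` are integral.
    set u : ι → L := w - ∑ b ∈ B, w b • D b with hu
    have huW : u ∈ W :=
      W.sub_mem hwW (W.sum_mem fun b hb => W.smul_mem _ ((hmem _).1 (h1 b hb)).1)
    have hua : u a = 1 := by
      rw [hu, Pi.sub_apply, Finset.sum_apply, Finset.sum_eq_zero, hwa, sub_zero]
      intro b hb
      simp [hDa b hb]
    have huB : ∀ c ∈ B, u c = 0 := by
      intro c hc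
      rw [hu, Pi.sub_apply, Finset.sum_apply, Finset.sum_eq_single_of_mem c hc]
      · simp [h2 c hc c hc]
      · intro b hb hbc
        simp [h2 b hb c hc, hbc]
    have huv : ∀ k, v (u k) ≤ 1 := by
      intro k
      rw [hu, Pi.sub_apply, Finset.sum_apply]
      refine (v.map_sub _ _).trans (max_le (hwv k) (v.map_sum_le fun b hb => ?_))
      rw [Pi.smul_apply, smul_eq_mul, map_mul]
      exact mul_le_one' (hwv b) (h3 b hb k)
    have hDb : ∀ b ∈ B, Function.update D a u b = D b := by
      intro b hb
      rw [Function.update_of_ne]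
      rintro rfl
      exact haB hb
    refine ⟨insert a B, Function.update D a u, ?_, ?_, ?_, ?_⟩
    · simp only [Finset.forall_mem_insert, Function.update_self]
      exact ⟨huW, fun b hb => hDb b hb ▸ ((hmem _).1 (h1 b hb)).1⟩
    · simp only [Finset.forall_mem_insert, Function.update_self]
      refine ⟨⟨by simp [hua], fun c hc => ?_⟩, fun b hb => ⟨?_, fun c hc => ?_⟩⟩
      · rw [huB c hc, if_neg]
        rintro rfl
        exact haB hc
      · rw [hDb b hb, hDa b hb, if_neg]
        rintro rfl
        exact haB hb
      · rw [hDb b hb, h2 b hb c hc]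
    · simp only [Finset.forall_mem_insert, Function.update_self]
      exact ⟨huv, fun b hb => hDb b hb ▸ h3 b hb⟩
    · intro x hx
      rw [Finset.sum_insert haB, Function.update_self]
      have hx' : x - x a • u ∈ W' := (hmem _).2 ⟨W.sub_mem hx (W.smul_mem _ huW), by simp [hua]⟩
      rw [← sub_eq_iff_eq_add', h4 _ hx']
      refine Finset.sum_congr rfl fun b hb => ?_
      simp [hDb b hb, huB b hb]

/-- If no element of `W` has its maximal value at the coordinate `i` only, then `W^⊥` contains an
integral element whose `i`-th coordinate is a unit. -/
theorem exists_integral_orthogonal (v : Valuation L Γ₀) (W : Submodule L (ι → L)) (i : ι)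
    (hi : ∀ D ∈ W, ¬ DominatedAt v 1 D i) :
    ∃ y : ι → L, (∀ D ∈ W, ∑ k, D k * y k = 0) ∧ (∀ k, v (y k) ≤ 1) ∧ v (y i) = 1 := by
  classical
  obtain ⟨B, D, h1, h2, h3, h4⟩ := exists_integral_echelon_basis v _ W rfl
  -- The standard basis of the orthogonal space read off from a reduced echelon form: one vector for
  -- each non-pivot `j`, with entries `-D b j` at the pivots.
  have key : ∀ j, j ∉ B → ∃ y : ι → L, (∀ D ∈ W, ∑ k, D k * y k = 0) ∧ (∀ k, v (y k) ≤ 1) ∧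
      y j = 1 ∧ ∀ b ∈ B, y b = - D b j := by
    intro j hj
    refine ⟨fun k => if k ∈ B then - D k j else if k = j then 1 else 0, ?_, ?_, ?_, ?_⟩
    · intro w hw
      have hwj : w j = ∑ b ∈ B, w b * D b j := by
        conv_lhs => rw [h4 w hw]
        simp
      have hsplit : ∀ k, w k * (if k ∈ B then - D k j else if k = j then 1 else 0) =
          (if k ∈ B then - (w k * D k j) else 0) + if k = j then w j else 0 := by
        intro k
        by_cases hk : k ∈ B
        · have hkj : k ≠ j := by
            rintro rfl
            exact hj hk
          simp [hk, hkj]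
        · by_cases hkj : k = j
          · subst hkj
            simp [hk]
          · simp [hk, hkj]
      rw [Finset.sum_congr rfl fun k _ => hsplit k, Finset.sum_add_distrib]
      simp [hwj]
    · intro k
      dsimp only
      split_ifs with hk hkj
      · rw [v.map_neg]
        exact h3 k hk j
      · simp
      · simp
    · simp [hj]
    · intro b hb
      simp [hb]
  -- If `i` is a pivot, its row has value `1` at `i` and is not dominated there, so another entry `D
  -- i j` also has value `1`, and the orthogonal vector of `j` has the unit `-D i j` at `i`. If `i`
  -- is not a pivot, its own orthogonal vector works.
  by_cases hiB : i ∈ B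
  · have hDi : D i i = 1 := by simp [h2 i hiB i hiB]
    have h5 := hi _ (h1 i hiB)
    simp only [DominatedAt, hDi, Pi.one_apply, map_one, one_mul, ne_eq, one_ne_zero,
      not_false_eq_true, true_and, not_forall, not_lt] at h5
    obtain ⟨j, hji, hj⟩ := h5
    have hjB : j ∉ B := by
      intro h
      rw [h2 i hiB j h, if_neg (Ne.symm hji), map_zero] at hj
      exact absurd hj (by simp)
    obtain ⟨y, hy1, hy2, -, hy3⟩ := key j hjB
    refine ⟨y, hy1, hy2, ?_⟩
    rw [hy3 i hiB, v.map_neg]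
    exact le_antisymm (h3 i hiB j) hj
  · obtain ⟨y, hy1, hy2, hy3, -⟩ := key i hiB
    exact ⟨y, hy1, hy2, by rw [hy3, map_one]⟩

/-- If every nonzero element of `W` contains the support of an element of `𝒟 ⊆ W`, and no element
of `𝒟` is dominated at `i`, then no element of `W` is. -/
theorem not_dominatedAt_of_mem (v : Valuation L Γ₀) (W : Submodule L (ι → L))
    (𝒟 : Set (ι → L)) (h𝒟 : 𝒟 ⊆ W)
    (hsupp : ∀ D ∈ W, D ≠ 0 → ∃ C ∈ 𝒟, C ≠ 0 ∧ Function.support C ⊆ Function.support D)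
    (X : ι → Γ₀) (i : ι) (hX : ∀ C ∈ 𝒟, ¬ DominatedAt v X C i) :
    ∀ D ∈ W, ¬ DominatedAt v X D i := by
  classical
  suffices h : ∀ n : ℕ, ∀ D ∈ W, (Function.support D).ncard = n → ¬ DominatedAt v X D i from
    fun D hD => h _ D hD rfl
  intro n
  induction n using Nat.strong_induction_on with
  | _ n ih =>
    rintro D hD hn ⟨hi, hdom⟩
    have hD0 : D ≠ 0 := by
      rintro rfl
      simp at hi
    obtain ⟨C, hC, hC0, hCD⟩ := hsupp D hD hD0
    obtain ⟨l, hl⟩ := Function.ne_iff.1 hC0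
    -- Taking the ratio of least value makes `c • C` at most `D` in value at every coordinate, while
    -- the two cancel at `j`.
    obtain ⟨j, hj, hmin⟩ := (Finset.univ.filter fun k => C k ≠ 0).exists_min_image
      (fun k => v (D k / C k)) ⟨l, by simpa using hl⟩
    have hCj : C j ≠ 0 := by simpa using hj
    have hDj : D j ≠ 0 := hCD hCj
    set c := D j / C j with hc
    have hc0 : c ≠ 0 := div_ne_zero hDj hCj
    have hcv : v c ≠ 0 := by simpa using hc0
    have hle : ∀ k, v c * v (C k) ≤ v (D k) := by
      intro k
      by_cases hk : C k = 0
      · simp [hk]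
      · have h := hmin k (by simpa using hk)
        rw [map_div₀ v (D k)] at h
        rwa [le_div_iff₀ (by simpa [zero_lt_iff] using hk)] at h
    -- If `c • C` has the same value as `D` at `i`, then `C` inherits the domination. Otherwise `D -
    -- c • C` keeps the value of `D` at `i`, grows nowhere and loses `j` from its support.
    by_cases heq : v c * v (C i) = v (D i)
    · refine hX C hC ⟨?_, ?_⟩
      · rw [← heq] at hi
        intro h
        apply hi
        rw [mul_left_comm, h, mul_zero]
      · intro k hk
        have h := (mul_le_mul_right (hle k) (X k)).trans_lt (hdom k hk)
        rw [← heq, mul_left_comm, mul_left_comm (X i)] at h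
        exact lt_of_mul_lt_mul_left' h
    · have hlt := lt_of_le_of_ne (hle i) heq
      have hE : D - c • C ∈ W := W.sub_mem hD (W.smul_mem _ (h𝒟 hC))
      have hEi : v ((D - c • C) i) = v (D i) := by
        rw [Pi.sub_apply, Pi.smul_apply, smul_eq_mul]
        exact v.map_sub_eq_of_lt_left (by rwa [map_mul])
      have hEk : ∀ k, v ((D - c • C) k) ≤ v (D k) := by
        intro k
        rw [Pi.sub_apply, Pi.smul_apply, smul_eq_mul]
        refine (v.map_sub _ _).trans (max_le le_rfl ?_)
        rw [map_mul]
        exact hle k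
      have hss : Function.support (D - c • C) ⊂ Function.support D := by
        refine ⟨?_, ?_⟩
        · intro k hk hDk
          have h := hEk k
          rw [hDk, map_zero, le_zero_iff, map_eq_zero] at h
          exact hk h
        · intro h
          exact h hDj (by simp [hc, hCj])
      refine ih _ (hn ▸ Set.ncard_lt_ncard hss (Set.toFinite _)) _ hE rfl ⟨hEi ▸ hi, ?_⟩
      intro k hk
      rw [hEi]
      exact (mul_le_mul_right (hEk k) (X k)).trans_lt (hdom k hk)

end ValuedLinearAlgebra

/-! ## Orthogonality in fields and in the tropical hyperfield -/

section Orthogonality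

theorem fieldTract_orthogonal_iff {K E : Type*} [Field K] [Fintype E] (X Y : E → K) :
    (fieldTract K).Orthogonal X Y ↔ ∑ k, X k * Y k = 0 := by
  classical
  have h1 : ∀ x : K, formalSumValue (formalTerm x) = x := by
    intro x
    unfold formalTerm
    by_cases h : x = 0
    · rw [dif_pos h, h]
      simp [formalSumValue]
    · rw [dif_neg h, formalSumValue_single]
      simp
  have h2 : ∀ s : Finset E, formalSumValue (∑ k ∈ s, formalTerm (X k * Y k))
      = ∑ k ∈ s, X k * Y k := by
    intro s
    induction s using Finset.induction_on with
    | empty => simp [formalSumValue]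
    | insert k s hk ih => rw [Finset.sum_insert hk, Finset.sum_insert hk, formalSumValue_add, h1, ih]
  change formalSumValue _ = 0 ↔ _
  rw [h2]

theorem coeff_sum_formalTerm {F E : Type*} [CommGroupWithZero F] [DecidableEq F] [Fintype E]
    (f : E → F) (z : Fˣ) :
    (∑ k, formalTerm (f k)).coeff z = (Finset.univ.filter fun k => f k = z).card := by
  rw [MonoidAlgebra.coeff_sum, Finsupp.finsetSum_apply, Finset.card_filter]
  refine Finset.sum_congr rfl fun k _ => ?_
  unfold formalTerm
  by_cases h : f k = 0
  · rw [dif_pos h, if_neg]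
    · simp
    · rw [h]
      exact z.ne_zero.symm
  · rw [dif_neg h, MonoidAlgebra.coeff_single, Finsupp.single_apply]
    congr 1
    rw [Units.ext_iff, Units.val_mk0]

/-- A formal sum with a unique maximal term is not null in the tropical hyperfield. -/
theorem sum_formalTerm_notMem_nullSet {Γ E : Type*} [AddCommGroup Γ] [LinearOrder Γ]
    [IsOrderedAddMonoid Γ] [Fintype E] (f : E → WithZero (Multiplicative Γ)) (i : E)
    (hi : f i ≠ 0) (hlt : ∀ k, k ≠ i → f k < f i) :
    ∑ k, formalTerm (f k) ∉ (tropicalTract Γ).nullSet := by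
  classical
  have hci : (∑ k, formalTerm (f k)).coeff (Units.mk0 (f i) hi) ≠ 0 := by
    rw [coeff_sum_formalTerm, Finset.card_ne_zero]
    exact ⟨i, Finset.mem_filter.2 ⟨Finset.mem_univ i, rfl⟩⟩
  rintro (h | ⟨m, hm, hmax⟩)
  · simp [h] at hci
  · rw [coeff_sum_formalTerm] at hm
    obtain ⟨a, ha, b, hb, hab⟩ := Finset.one_lt_card.1 hm
    simp only [Finset.mem_filter, Finset.mem_univ, true_and] at ha hb
    have hle := hmax _ hci
    rw [Units.val_mk0] at hle
    -- The repeated maximum `m` is at least `f i`, which only the index `i` attains.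
    have key : ∀ k, f k = m → k = i := by
      intro k hk
      by_contra h
      exact absurd (hlt k h) (not_lt.2 (hk ▸ hle))
    exact hab ((key a ha).trans (key b hb).symm)

end Orthogonality

/-! ## Fields of Hahn series -/

section HahnLift

variable {Γ : Type*} [AddCommGroup Γ] [LinearOrder Γ]
  {K : Type*} [Field K]

theorem hahnValue_single (a : Γ) {c : K} (hc : c ≠ 0) :
    hahnValue (HahnSeries.single a c) = WithZero.exp (-a) := by
  rw [hahnValue_of_ne_zero (HahnSeries.single_ne_zero hc), HahnSeries.order_single hc]

/-- With `one_le_hahnValue_of_coeff_zero_ne_zero`, this detects units among integral series by their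
constant coefficient, that is, by their residue in `K`. -/
theorem coeff_zero_ne_zero_of_hahnValue_eq_one {x : HahnSeries Γ K} (h : hahnValue x = 1) :
    x.coeff 0 ≠ 0 := by
  have hx : x ≠ 0 := by
    rintro rfl
    simp [hahnValue] at h
  rw [hahnValue_of_ne_zero hx, ← WithZero.exp_zero, WithZero.exp_inj, neg_eq_zero] at h
  rw [← h]
  exact HahnSeries.coeff_order_eq_zero.not.2 hx

variable [IsOrderedAddMonoid Γ]

theorem hahnValue_add_le (x y : HahnSeries Γ K) :
    hahnValue (x + y) ≤ max (hahnValue x) (hahnValue y) := by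
  by_cases hx : x = 0
  · simp [hx]
  by_cases hy : y = 0
  · simp [hy]
  by_cases hxy : x + y = 0
  · simp [hxy, hahnValue]
  rw [hahnValue_of_ne_zero hx, hahnValue_of_ne_zero hy, hahnValue_of_ne_zero hxy]
  rcases min_le_iff.1 (HahnSeries.min_order_le_order_add hxy) with h | h
  · exact le_max_of_le_left (WithZero.exp_le_exp.2 (neg_le_neg h))
  · exact le_max_of_le_right (WithZero.exp_le_exp.2 (neg_le_neg h))

/-- The valuation of a subfield of `K((T^Γ))`. -/
noncomputable def hahnValuation (L : Subfield (HahnSeries Γ K)) :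
    Valuation L (WithZero (Multiplicative Γ)) where
  toMonoidWithZeroHom := hahnValueHom L
  map_add_le_max' x y := hahnValue_add_le (x : HahnSeries Γ K) y

theorem one_le_hahnValue_of_coeff_zero_ne_zero {x : HahnSeries Γ K} (h : x.coeff 0 ≠ 0) :
    1 ≤ hahnValue x := by
  have hx : x ≠ 0 := by
    rintro rfl
    simp at h
  rw [hahnValue_of_ne_zero hx, ← WithZero.exp_zero, WithZero.exp_le_exp]
  simpa using HahnSeries.order_le_of_coeff_ne_zero h

variable {ι : Type*} [Fintype ι]

/-- If `W^⊥` contains, for each `i ∈ S`, an integral element whose `i`-th coordinate is a unit, then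
it contains an integral element whose coordinates in `S` are all units. -/
theorem exists_orthogonal_forall_unit [Infinite K] (L : Subfield (HahnSeries Γ K))
    (hL : ∀ c, HahnSeries.single 0 c ∈ L) (W : Submodule L (ι → L)) (S : Set ι)
    (h : ∀ i ∈ S, ∃ y : ι → L, (∀ D ∈ W, ∑ k, D k * y k = 0) ∧
      (∀ k, hahnValuation L (y k) ≤ 1) ∧ hahnValuation L (y i) = 1) :
    ∃ y : ι → L, (∀ D ∈ W, ∑ k, D k * y k = 0) ∧ ∀ i ∈ S, hahnValuation L (y i) = 1 := by
  classical
  choose! Y hY1 hY2 hY3 using h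
  -- `f k c` is the constant coefficient of the `k`-th coordinate of `∑ c i • Y i`. It is nonzero as
  -- a form in `c`, since `Y k` has a unit at `k`.
  set f : S → Module.Dual K (S → K) := fun k =>
    ∑ i : S, ((Y i k : L) : HahnSeries Γ K).coeff 0 • LinearMap.proj i with hf
  have hfc : ∀ k c, f k c = ∑ i : S, ((Y i k : L) : HahnSeries Γ K).coeff 0 * c i := by
    intro k c
    simp [hf]
  obtain ⟨c, hc⟩ := Module.Dual.exists_forall_ne_zero_of_forall_exists f (by
    intro k
    refine ⟨Pi.single k 1, ?_⟩
    rw [hfc]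
    simpa [Pi.single_apply] using coeff_zero_ne_zero_of_hahnValue_eq_one (hY3 k k.2))
  set C : K → L := fun a => ⟨HahnSeries.single 0 a, hL a⟩ with hC
  have hCv : ∀ a, hahnValuation L (C a) ≤ 1 := by
    intro a
    change hahnValue (HahnSeries.single 0 a) ≤ 1
    by_cases ha : a = 0
    · simp [ha, hahnValue]
    · simp [hahnValue_single (0 : Γ) ha]
  refine ⟨fun k => ∑ i : S, C (c i) * Y i k, ?_, ?_⟩
  · intro D hD
    simp_rw [Finset.mul_sum]
    rw [Finset.sum_comm]
    refine Finset.sum_eq_zero fun i _ => ?_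
    rw [Finset.sum_congr rfl fun k _ => mul_left_comm (D k) (C (c i)) (Y i k), ← Finset.mul_sum,
      hY1 i i.2 D hD, mul_zero]
  · intro k hk
    refine le_antisymm ?_ ?_
    · refine (hahnValuation L).map_sum_le fun i _ => ?_
      rw [map_mul]
      exact mul_le_one' (hCv _) (hY2 i i.2 k)
    · refine one_le_hahnValue_of_coeff_zero_ne_zero ?_
      have h1 := hc ⟨k, hk⟩
      rw [hfc] at h1
      convert h1 using 1
      rw [← Subfield.coe_subtype, map_sum, HahnSeries.coeff_sum]
      refine Finset.sum_congr rfl fun i _ => ?_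
      rw [map_mul, mul_comm]
      exact HahnSeries.coeff_mul_single_zero

/-- If no element of `W` is dominated at a coordinate for the weight `X`, then `X` is the
coordinatewise value of an element of `W^⊥`. -/
theorem exists_orthogonal_hahnValuation_eq [Infinite K] (L : Subfield (HahnSeries Γ K))
    (hL : ∀ a c, HahnSeries.single a c ∈ L) (W : Submodule L (ι → L))
    (X : ι → WithZero (Multiplicative Γ))
    (hX : ∀ i, ∀ D ∈ W, ¬ DominatedAt (hahnValuation L) X D i) :
    ∃ x : ι → L, (∀ D ∈ W, ∑ k, D k * x k = 0) ∧ ∀ k, hahnValuation L (x k) = X k := by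
  have hsurj : ∀ z : WithZero (Multiplicative Γ), ∃ t : L, hahnValuation L t = z := by
    intro z
    by_cases hz : z = 0
    · exact ⟨0, by simp [hz]⟩
    · refine ⟨⟨HahnSeries.single (-WithZero.log z) 1, hL _ _⟩, ?_⟩
      change hahnValue (HahnSeries.single (-WithZero.log z) 1) = z
      rw [hahnValue_single _ one_ne_zero, neg_neg, WithZero.exp_log hz]
  choose t ht using fun k => hsurj (X k)
  -- Coordinates with `X k = 0` have `t k = 0` and are erased here; the lift `t k * y k` vanishes
  -- there, as required.
  set W' : Submodule L (ι → L) :=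
    W.map (LinearMap.pi fun k => t k • LinearMap.proj (R := L) (φ := fun _ : ι => L) k) with hW'
  have hmem : ∀ D ∈ W, (fun k => t k * D k) ∈ W' := by
    intro D hD
    exact ⟨D, hD, by ext k; simp⟩
  have hdom : ∀ i, X i ≠ 0 → ∀ D ∈ W', ¬ DominatedAt (hahnValuation L) 1 D i := by
    rintro i - _ ⟨D, hD, rfl⟩ h
    apply hX i D hD
    simpa [DominatedAt, ht] using h
  obtain ⟨y, hy1, hy2⟩ := exists_orthogonal_forall_unit L (hL 0) W' {i | X i ≠ 0} fun i hi =>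
    exists_integral_orthogonal (hahnValuation L) W' i (hdom i hi)
  refine ⟨fun k => t k * y k, ?_, ?_⟩
  · intro D hD
    rw [← hy1 _ (hmem D hD)]
    exact Finset.sum_congr rfl fun k _ => by ring
  · intro k
    rw [map_mul, ht]
    by_cases hk : X k = 0
    · rw [hk, zero_mul]
    · rw [hy2 k hk, mul_one]

end HahnLift

/-! ## Matroids over a field -/

section MatroidLift

/-- A nonempty set that meets no circuit in exactly one element contains a cocircuit. -/
theorem Matroid.exists_isCocircuit_subset {E : Type*} [Finite E] (M : Matroid E)
    (hM : M.E = Set.univ) (S : Set E) (hS : S.Nonempty)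
    (h : ∀ C e, M.IsCircuit C → C ∩ S ≠ {e}) : ∃ D, M.IsCocircuit D ∧ D ⊆ S := by
  obtain ⟨e, he⟩ := hS
  -- Were the complement of `S` spanning, some circuit through `e` would lie in that complement
  -- together with `e`, and would meet `S` in `e` alone.
  have hns : ¬ M.Spanning (M.E \ S) := by
    intro hsp
    have hcl : e ∈ M.closure (M.E \ S) := by
      rw [hsp.closure_eq, hM]
      trivial
    obtain ⟨C, hC, hCc, heC⟩ := M.exists_isCircuit_of_mem_closure hcl fun h => h.2 he
    refine h C e hCc (Set.Subset.antisymm ?_ (Set.singleton_subset_iff.2 ⟨heC, he⟩))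
    rintro x ⟨hxC, hxS⟩
    rcases hC hxC with hx | hx
    · exact hx
    · exact absurd hxS hx.2
  obtain ⟨D, hDS, hD⟩ := exists_minimal_le_of_wellFoundedLT (fun X => ¬ M.Spanning (M.E \ X)) S hns
  exact ⟨D, Matroid.isCocircuit_iff_minimal_compl_nonspanning.2 hD, hDS⟩

variable {E : Type*} [Fintype E]

/-- The subspace orthogonal to a set. -/
def orthogonalSubspace {L : Type*} [Field L] (𝒞 : Set (E → L)) : Submodule L (E → L) where
  carrier := {D | ∀ C ∈ 𝒞, ∑ k, D k * C k = 0}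
  zero_mem' := by
    intro C _
    simp
  add_mem' := by
    intro a b ha hb C hC
    simp [add_mul, Finset.sum_add_distrib, ha C hC, hb C hC]
  smul_mem' := by
    intro a b hb C hC
    simp [mul_assoc, ← Finset.mul_sum, hb C hC]

/-- If the support of `D` met a circuit in a single element, the orthogonality sum would reduce to
one nonzero product. So the support meets no circuit exactly once, and it contains a cocircuit. -/
theorem exists_mem_support_subset {L : Type*} [Field L] (M : Matroid E) (hM : M.E = Set.univ)
    (𝒞 𝒟 : Set (E → L))
    (h𝒞 : ∀ S, M.IsCircuit S → ∃ C ∈ 𝒞, Function.support C = S)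
    (h𝒟 : ∀ S, M.IsCocircuit S → ∃ D ∈ 𝒟, Function.support D = S)
    (D : E → L) (hD : D ∈ orthogonalSubspace 𝒞) (hD0 : D ≠ 0) :
    ∃ C ∈ 𝒟, C ≠ 0 ∧ Function.support C ⊆ Function.support D := by
  obtain ⟨S, hS, hSD⟩ := M.exists_isCocircuit_subset hM (Function.support D)
    (Function.support_nonempty_iff.2 hD0) (by
      intro S e hS he
      obtain ⟨C, hC, rfl⟩ := h𝒞 S hS
      have hmem : ∀ k, C k ≠ 0 ∧ D k ≠ 0 ↔ k = e := fun k => by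
        simpa using Set.ext_iff.1 he k
      have h1 := hD C hC
      rw [Finset.sum_eq_single e] at h1
      · have h2 := (hmem e).2 rfl
        exact mul_ne_zero h2.2 h2.1 h1
      · intro k _ hk
        by_contra h
        exact hk ((hmem k).1 ⟨right_ne_zero_of_mul h, left_ne_zero_of_mul h⟩)
      · simp)
  obtain ⟨C, hC, rfl⟩ := h𝒟 S hS
  exact ⟨C, hC, Function.support_nonempty_iff.1 hS.nonempty, hSD⟩

variable {Γ : Type*} [AddCommGroup Γ] [LinearOrder Γ] [IsOrderedAddMonoid Γ]
  {K : Type*} [Field K] [Infinite K]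

/-- A tropical vector orthogonal to the values of the cocircuits `𝒟` lifts to a vector orthogonal
to `𝒟`. -/
theorem exists_orthogonal_lift (L : Subfield (HahnSeries Γ K))
    (hL : ∀ a c, HahnSeries.single a c ∈ L) (M : Matroid E) (hM : M.E = Set.univ)
    (𝒞 𝒟 : Set (E → L))
    (h𝒞 : ∀ S, M.IsCircuit S → ∃ C ∈ 𝒞, Function.support C = S)
    (h𝒟 : ∀ S, M.IsCocircuit S → ∃ D ∈ 𝒟, Function.support D = S)
    (horth : ∀ C ∈ 𝒞, ∀ D ∈ 𝒟, ∑ k, C k * D k = 0)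
    (X : E → WithZero (Multiplicative Γ))
    (hX : ∀ D ∈ 𝒟, (tropicalTract Γ).Orthogonal X fun k => hahnValueHom L (D k)) :
    ∃ x : E → L, (∀ D ∈ 𝒟, ∑ k, x k * D k = 0) ∧ ∀ k, hahnValueHom L (x k) = X k := by
  have hsub : 𝒟 ⊆ orthogonalSubspace 𝒞 := by
    intro D hD C hC
    simpa only [mul_comm] using horth C hC D hD
  obtain ⟨x, hx1, hx2⟩ := exists_orthogonal_hahnValuation_eq L hL (orthogonalSubspace 𝒞) X
    fun i => not_dominatedAt_of_mem (hahnValuation L) (orthogonalSubspace 𝒞) 𝒟 hsub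
      (exists_mem_support_subset M hM 𝒞 𝒟 h𝒞 h𝒟) X i
      fun D hD hdom => sum_formalTerm_notMem_nullSet _ i hdom.1 hdom.2 (hX D hD)
  refine ⟨x, fun D hD => ?_, hx2⟩
  simpa only [mul_comm] using hx1 D (hsub hD)

theorem vectorMap_surjective (L : Subfield (HahnSeries Γ K))
    (hL : ∀ a c, HahnSeries.single a c ∈ L) (M : TractMatroid (fieldTract L) E) :
    Function.Surjective ((tropicalValuation L).vectorMap M) := by
  rintro ⟨X, hX⟩
  obtain ⟨x, hx1, hx2⟩ := exists_orthogonal_lift L hL M.toMatroid M.ground_eq M.circuits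
    M.cocircuits M.exists_circuit M.exists_cocircuit
    (fun C hC D hD => (fieldTract_orthogonal_iff C D).1 (M.orthogonal C hC D hD)) X
    fun D hD => hX _ ⟨1, D, hD, by simp [tropicalValuation]⟩
  exact ⟨⟨x, fun D hD => (fieldTract_orthogonal_iff x D).2 (hx1 D hD)⟩,
    Subtype.ext (funext hx2)⟩

/-- Passing to the dual matroid exchanges circuits with cocircuits, so the same lifting result
applies. -/
theorem covectorMap_surjective (L : Subfield (HahnSeries Γ K))
    (hL : ∀ a c, HahnSeries.single a c ∈ L) (M : TractMatroid (fieldTract L) E) :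
    Function.Surjective ((tropicalValuation L).covectorMap M) := by
  rintro ⟨X, hX⟩
  obtain ⟨x, hx1, hx2⟩ := exists_orthogonal_lift L hL M.toMatroid✶ M.ground_eq M.cocircuits
    M.circuits M.exists_cocircuit
    (fun S hS => M.exists_circuit S (M.toMatroid.dual_isCocircuit_iff.1 hS))
    (fun C hC D hD => by
      simpa only [mul_comm] using (fieldTract_orthogonal_iff D C).1 (M.orthogonal D hD C hC)) X
    fun D hD => hX _ ⟨1, D, hD, by simp [tropicalValuation]⟩
  exact ⟨⟨x, fun D hD => (fieldTract_orthogonal_iff x D).2 (hx1 D hD)⟩,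
    Subtype.ext (funext hx2)⟩

end MatroidLift

/-! ## Monomials in the fields of Puiseux series -/

theorem single_mem_realPuiseuxSeries (K : Type*) [Field K] (a : ℝ) (c : K) :
    HahnSeries.single a c ∈ RealPuiseuxSeries K :=
  HasLeftFiniteSupport.single a c

theorem single_mem_puiseuxSeries (K : Type*) [Field K] (a : ℚ) (c : K) :
    HahnSeries.single a c ∈ PuiseuxSeries K := by
  -- With `a = p / q` in lowest terms, `c T^a` is the image of `c T^p` under `T ↦ T^{1/q}`.
  refine (le_iSup (fun n : ℕ+ => (laurentRootHom K n).fieldRange) ⟨a.den, a.den_pos⟩)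
    ⟨HahnSeries.single a.num c, ?_⟩
  refine HahnSeries.embDomain_single.trans ?_
  exact congrArg (fun b => HahnSeries.single b c) a.num_div_den

theorem mainTheorem7 (K : Type*) [Field K] [Infinite K] :
    ((tropicalValuation (RealPuiseuxSeries K)).IsEpic ∧
      ∀ (n : ℕ) (M : TractMatroid (fieldTract (RealPuiseuxSeries K)) (Fin n)),
        Function.Surjective ((tropicalValuation (RealPuiseuxSeries K)).covectorMap M)) ∧
    ((tropicalValuation (PuiseuxSeries K)).IsEpic ∧
      ∀ (n : ℕ) (M : TractMatroid (fieldTract (PuiseuxSeries K)) (Fin n)),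
        Function.Surjective ((tropicalValuation (PuiseuxSeries K)).covectorMap M)) := by
  exact ⟨⟨fun _ => vectorMap_surjective _ (single_mem_realPuiseuxSeries K),
    fun _ => covectorMap_surjective _ (single_mem_realPuiseuxSeries K)⟩,
    ⟨fun _ => vectorMap_surjective _ (single_mem_puiseuxSeries K),
    fun _ => covectorMap_surjective _ (single_mem_puiseuxSeries K)⟩⟩
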